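/- Let $x=(x_1,x_2,\dots)$ be infinitely many variables and $\beta$ a further indeterminate. For $p\ge 1$ and $m\in\mathbb Z$ define $G^{[p]}_m(x)\in\mathbb Z[\beta][[x]]$ by $$\sum_{m\in\mathbb Z}G^{[p]}_m(x)\,u^m=\frac{1}{1+\beta u^{-1}}\prod_{1\le i\le p}\frac{1+\beta x_i}{1-x_iu},$$ where $\frac1{1+\beta u^{-1}}=\sum_{k\ge0}(-\beta)^ku^{-k}$ and $\frac1{1-x_iu}=\sum_{k\ge0}x_i^ku^k$. Let $\lambda=(\lambda_1\ge\dots\ge\lambda_r)$ be a partition with $r\ge 0$ positive parts, and let $f=(f_1\le\dots\le f_r)$ be a flagging of $\lambda$, i.e. a weakly increasing sequence of positive integers. A flagged set-valued tableau $T$ of shape $\lambda$ with flagging $f$ is a filling of the boxes $(i,j)$, $1\le i\le r$, $1\le j\le\lambda_i$, of the Young diagram of $\lambda$ such that the box $(i,j)$ is filled with a non-empty subset of $\{1,\dots,f_i\}$ whose maximum is at most the minimum of box $(i,j+1)$ if $j+1\le\lambda_i$, and less than the minimum of box $(i+1,j)$ if $i<r$ and $j\le\lambda_{i+1}$. Let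 $FSVT(\lambda,f)$ be the finite set of all these tableaux and put $$G_{\lambda,f}(x)=\sum_{T\in FSVT(\lambda,f)}\beta^{|T|-|\lambda|}\prod_{k\in T}x_k\in\mathbb Z[\beta][x],$$ where $|T|$ is the total number of entries of $T$, $|\lambda|=\lambda_1+\dots+\lambda_r$, and the product runs over all entries $k$ of $T$ (counted once for each box in which they occur). **Theorem.** For every partition $\lambda$ of length $r$ and every flagging $f$ of $\lambda$, in $\mathbb Z[\beta][[x]]$, $$G_{\lambda,f}(x)=\det\left(\sum_{s=0}^{\infty}\binom{i-j}{s}\beta^s\,G^{[f_i]}_{\lambda_i+j-i+s}(x)\right)_{1\le i,j\le r},$$ where $\binom{a}{s}=a(a-1)\cdots(a-s+1)/s!$ for every integer $a$, and the infinite sums converge coefficientwise in the monomials in $x$; for $r=0$ both sides are $1$. In particular, the determinant on the right-hand side is a polynomial in $x$ with coefficients in $\mathbb Z[\beta]$. -/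

import Mathlib

noncomputable section

namespace FlaggedGrothendieck

/-- The ring `ℤ[β][[x]]` of formal power series in `x = (x₁, x₂, …)` over `ℤ[β]`. -/
abbrev PS : Type := MvPowerSeries ℕ+ (Polynomial ℤ)

/-- The ring `ℤ[β][x]` of polynomials in `x = (x₁, x₂, …)` over `ℤ[β]`. -/
abbrev Pol : Type := MvPolynomial ℕ+ (Polynomial ℤ)

/-- The parameter `β`, as an element of `ℤ[β][[x]]`. -/
def beta : PS := MvPowerSeries.C (Polynomial.X : Polynomial ℤ)

/-- The variable `x_i`, as an element of `ℤ[β][[x]]`. -/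
def var (i : ℕ+) : PS := MvPowerSeries.X i

/-! ### Infinite sums in `ℤ[β][[x]]` -/

/-- A family of power series is summable if every monomial in `x` has a nonzero coefficient in
only finitely many members. -/
def CoeffSummable {ι : Type*} (F : ι → PS) : Prop :=
  ∀ n : ℕ+ →₀ ℕ, {i | MvPowerSeries.coeff n (F i) ≠ 0}.Finite

/-- The sum of a summable family, computed coefficient by coefficient. -/
def coeffSum {ι : Type*} (F : ι → PS) : PS :=
  fun n => ∑ᶠ i, MvPowerSeries.coeff n (F i)

/-! ### The one-row functions `G_m^{[p]}` -/

/-- `1 / (1 - a u) = ∑_{n ≥ 0} aⁿ uⁿ`, a power series in the variable `u` with coefficients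
in `ℤ[β][[x]]`. -/
def geom (a : PS) : PowerSeries PS := PowerSeries.mk fun n => a ^ n

/-- `∏_{1 ≤ i ≤ p} (1 + β x_i) / (1 - x_i u)`, a power series in `u` over `ℤ[β][[x]]`. -/
def rowProd (p : ℕ+) : PowerSeries PS :=
  ∏ i ∈ Finset.Icc 1 p, (PowerSeries.C (1 + beta * var i) * geom (var i))

/-- The coefficient of `u^n` in `rowProd p` for an integer exponent `n`. -/
def rowProdCoeff (p : ℕ+) (n : ℤ) : PS :=
  if 0 ≤ n then PowerSeries.coeff n.toNat (rowProd p) else 0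

/-- `G_m^{[p]}`: the coefficient of `u^m` (`m ∈ ℤ`) in
`1 / (1 + β u⁻¹) * ∏_{1 ≤ i ≤ p} (1 + β x_i) / (1 - x_i u)`, where
`1 / (1 + β u⁻¹) = ∑_{k ≥ 0} (-β)^k u^{-k}`. -/
def oneRow (p : ℕ+) (m : ℤ) : PS :=
  coeffSum fun k : ℕ => (-beta) ^ k * rowProdCoeff p (m + k)

/-! ### The determinant side -/

/-- The `s`-th term of the `(i, j)` entry of the matrix: `binom(i-j, s) β^s G^{[f_i]}_{λ_i+j-i+s}`.
`Ring.choose` is the generalized binomial coefficient, with an arbitrary integer on top. -/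
def entryTerm {r : ℕ} (lam : Fin r → ℕ) (f : Fin r → ℕ+) (i j : Fin r) (s : ℕ) : PS :=
  ((Ring.choose ((i : ℤ) - (j : ℤ)) s : ℤ) : PS) * beta ^ s *
    oneRow (f i) ((lam i : ℤ) + (j : ℤ) - (i : ℤ) + (s : ℤ))

/-- The Jacobi-Trudi type determinant
`det (∑_{s ≥ 0} binom(i-j, s) β^s G^{[f_i]}_{λ_i+j-i+s})_{1 ≤ i, j ≤ r}`. -/
def jacobiTrudi {r : ℕ} (lam : Fin r → ℕ) (f : Fin r → ℕ+) : PS :=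
  Matrix.det (Matrix.of fun i j : Fin r => coeffSum (entryTerm lam f i j))

/-! ### The tableau side -/

/-- The boxes of the Young diagram of `lam`: pairs (row, column in that row). -/
abbrev Box {r : ℕ} (lam : Fin r → ℕ) : Type := Σ i : Fin r, Fin (lam i)

/-- A filling `T` of the boxes of `lam` by finite sets of positive integers is a flagged set-valued
tableau with flagging `f`: the sets are nonempty, the entries of row `i` are at most `f i`,
the maximum of a box is at most the minimum of its right neighbour, and less than the minimum of
the box just below it. -/
structure IsFSVT {r : ℕ} (lam : Fin r → ℕ) (f : Fin r → ℕ+) (T : Box lam → Finset ℕ+) :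
    Prop where
  nonempty : ∀ b, (T b).Nonempty
  flag : ∀ b, ∀ k ∈ T b, k ≤ f b.1
  row : ∀ (i : Fin r) (j j' : Fin (lam i)), (j' : ℕ) = j + 1 →
    ∀ k ∈ T ⟨i, j⟩, ∀ l ∈ T ⟨i, j'⟩, k ≤ l
  column : ∀ (i i' : Fin r) (j : Fin (lam i)) (j' : Fin (lam i')), (i' : ℕ) = i + 1 →
    (j' : ℕ) = j → ∀ k ∈ T ⟨i, j⟩, ∀ l ∈ T ⟨i', j'⟩, k < l

open Classical in
/-- The finite set `FSVT(λ, f)` of all flagged set-valued tableaux. -/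
def FSVT {r : ℕ} (lam : Fin r → ℕ) (f : Fin r → ℕ+) : Finset (Box lam → Finset ℕ+) :=
  (Fintype.piFinset fun b : Box lam => (Finset.Icc 1 (f b.1)).powerset).filter (IsFSVT lam f)

theorem mem_FSVT {r : ℕ} (lam : Fin r → ℕ) (f : Fin r → ℕ+) (T : Box lam → Finset ℕ+) :
    T ∈ FSVT lam f ↔ IsFSVT lam f T := by
  classical
  simp only [FSVT, Finset.mem_filter, Fintype.mem_piFinset, Finset.mem_powerset,
    and_iff_right_iff_imp]
  intro h b k hk
  exact Finset.mem_Icc.2 ⟨one_le, h.flag b k hk⟩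

/-- `|T|`, the total number of entries of `T`. -/
def size {r : ℕ} {lam : Fin r → ℕ} (T : Box lam → Finset ℕ+) : ℕ := ∑ b, (T b).card

/-- The exponent `|T| - |λ|` involves no truncation. -/
theorem card_le_size {r : ℕ} {lam : Fin r → ℕ} {f : Fin r → ℕ+} {T : Box lam → Finset ℕ+}
    (h : IsFSVT lam f T) : ∑ i, lam i ≤ size T := by
  have h1 : ∑ _b : Box lam, 1 ≤ size T :=
    Finset.sum_le_sum fun b _ => Finset.card_pos.2 (h.nonempty b)
  simpa using h1

/-- The flagged Grothendieck polynomial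
`G_{λ,f}(x) = ∑_{T ∈ FSVT(λ,f)} β^{|T|-|λ|} ∏_{k ∈ T} x_k`. -/
def flaggedGrothendieck {r : ℕ} (lam : Fin r → ℕ) (f : Fin r → ℕ+) : Pol :=
  ∑ T ∈ FSVT lam f,
    MvPolynomial.C ((Polynomial.X : Polynomial ℤ) ^ (size T - ∑ i, lam i)) *
      ∏ b, ∏ k ∈ T b, MvPolynomial.X k

/-! ### The infinite sums above converge -/

theorem one_sub_mul_geom (a : PS) : (1 - PowerSeries.C a * PowerSeries.X) * geom a = 1 := by
  ext1 n
  cases n with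
  | zero => simp [geom, sub_mul, mul_assoc]
  | succ n =>
    simp [geom, sub_mul, mul_assoc, PowerSeries.coeff_succ_X_mul, PowerSeries.coeff_one, pow_succ']

/-- The coefficient of `u^k` is of order at least `k` in `x`. -/
def HighOrder (S : PowerSeries PS) : Prop := ∀ k : ℕ, (k : ℕ∞) ≤ (PowerSeries.coeff k S).order

theorem HighOrder.mul {S S' : PowerSeries PS} (h : HighOrder S) (h' : HighOrder S') :
    HighOrder (S * S') := by
  intro k
  rw [PowerSeries.coeff_mul]
  refine MvPowerSeries.le_order fun d hd => ?_
  rw [map_sum]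
  refine Finset.sum_eq_zero fun q hq => ?_
  apply MvPowerSeries.coeff_of_lt_order
  refine lt_of_lt_of_le hd ?_
  rw [← Finset.HasAntidiagonal.mem_antidiagonal.1 hq, Nat.cast_add]
  exact (add_le_add (h _) (h' _)).trans MvPowerSeries.le_order_mul

theorem highOrder_C (a : PS) : HighOrder (PowerSeries.C a) := by
  intro k
  rw [PowerSeries.coeff_C]
  split_ifs with h
  · simp [h]
  · simp

theorem highOrder_geom (i : ℕ+) : HighOrder (geom (var i)) := by
  intro k
  rw [geom, PowerSeries.coeff_mk]
  exact MvPowerSeries.le_order_pow_of_constantCoeff_eq_zero k (by simp [var])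

theorem highOrder_rowProd (p : ℕ+) : HighOrder (rowProd p) := by
  refine Finset.prod_induction _ HighOrder (fun _ _ => HighOrder.mul) ?_ fun i _ =>
    (highOrder_C _).mul (highOrder_geom i)
  simpa using highOrder_C 1

theorem coeff_rowProdCoeff (p : ℕ+) (m : ℤ) (d : ℕ+ →₀ ℕ) (h : (d.degree : ℤ) < m) :
    MvPowerSeries.coeff d (rowProdCoeff p m) = 0 := by
  rw [rowProdCoeff]
  split_ifs
  · apply MvPowerSeries.coeff_of_lt_order
    refine lt_of_lt_of_le ?_ (highOrder_rowProd p _)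
    exact_mod_cast (by omega : d.degree < m.toNat)
  · simp

theorem coeff_oneRow_term (p : ℕ+) (m : ℤ) (k : ℕ) (d : ℕ+ →₀ ℕ) (h : (d.degree : ℤ) < m + k) :
    MvPowerSeries.coeff d ((-beta) ^ k * rowProdCoeff p (m + k)) = 0 := by
  have e : (-beta : PS) ^ k = MvPowerSeries.C ((-Polynomial.X : Polynomial ℤ) ^ k) := by
    simp [beta]
  rw [e, MvPowerSeries.coeff_C_mul, coeff_rowProdCoeff p _ d h, mul_zero]

/-- The sum defining `G_m^{[p]}` converges. -/
theorem oneRow_summable (p : ℕ+) (m : ℤ) :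
    CoeffSummable fun k : ℕ => (-beta) ^ k * rowProdCoeff p (m + k) := by
  intro d
  refine (Set.finite_Iic ((d.degree : ℤ) - m).toNat).subset fun k hk => ?_
  by_contra hk'
  refine hk (coeff_oneRow_term p m k d ?_)
  simp only [Set.mem_Iic, not_le] at hk'
  omega

theorem coeff_oneRow (p : ℕ+) (m : ℤ) (d : ℕ+ →₀ ℕ) (h : (d.degree : ℤ) < m) :
    MvPowerSeries.coeff d (oneRow p m) = 0 :=
  finsum_eq_zero_of_forall_eq_zero fun k => coeff_oneRow_term p m k d (by omega)

/-- The sums in the entries of the determinant converge. -/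
theorem entry_summable {r : ℕ} (lam : Fin r → ℕ) (f : Fin r → ℕ+) (i j : Fin r) :
    CoeffSummable (entryTerm lam f i j) := by
  intro d
  refine (Set.finite_Iic ((d.degree : ℤ) + i).toNat).subset fun s hs => ?_
  by_contra hs'
  refine hs ?_
  simp only [Set.mem_Iic, not_le] at hs'
  have e : ((Ring.choose ((i : ℤ) - (j : ℤ)) s : ℤ) : PS) * beta ^ s =
      MvPowerSeries.C (((Ring.choose ((i : ℤ) - (j : ℤ)) s : ℤ) : Polynomial ℤ) * Polynomial.X ^ s) := by
    simp [beta]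
  rw [entryTerm, e, MvPowerSeries.coeff_C_mul, coeff_oneRow _ _ d (by omega), mul_zero]

theorem coeff_oneRow_eq_sum (p : ℕ+) (m : ℤ) (d : ℕ+ →₀ ℕ) (N : ℕ)
    (h : (d.degree : ℤ) < m + N) :
    MvPowerSeries.coeff d (oneRow p m) = ∑ k ∈ Finset.range N,
      MvPowerSeries.coeff d ((-beta) ^ k * rowProdCoeff p (m + k)) := by
  refine finsum_eq_sum_of_support_subset _ fun k hk => ?_
  rw [Finset.mem_coe, Finset.mem_range]
  by_contra hk'
  exact hk (coeff_oneRow_term p m k d (by omega))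

/-- The defining generating function identity of `G_m^{[p]}`, multiplied by `1 + β u⁻¹`. -/
theorem oneRow_add (p : ℕ+) (m : ℤ) :
    oneRow p m + beta * oneRow p (m + 1) = rowProdCoeff p m := by
  ext1 d
  obtain ⟨N, hN⟩ : ∃ N : ℕ, (d.degree : ℤ) < m + N := ⟨((d.degree : ℤ) - m).toNat + 1, by omega⟩
  rw [map_add, coeff_oneRow_eq_sum p m d (N + 1) (by push_cast; omega), Finset.sum_range_succ',
    beta, MvPowerSeries.coeff_C_mul, coeff_oneRow_eq_sum p (m + 1) d N (by omega), Finset.mul_sum,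
    add_right_comm, ← Finset.sum_add_distrib]
  rw [Finset.sum_eq_zero]
  · simp
  · intro k _
    rw [← MvPowerSeries.coeff_C_mul, ← map_add]
    have e : m + ((k + 1 : ℕ) : ℤ) = m + 1 + k := by push_cast; ring
    rw [e, ← beta, pow_succ']
    have : -beta * (-beta) ^ k * rowProdCoeff p (m + 1 + k) +
        beta * ((-beta) ^ k * rowProdCoeff p (m + 1 + k)) = 0 := by ring
    rw [this, map_zero]

end FlaggedGrothendieck

end

/-!
The `(i, j)` entry of the determinant is the coefficient of `u ^ λ_i` in
`(u + β) ^ (i - j) * ∑ₙ G_n^{[f_i]} uⁿ`, called `rowH f_i (i - j) λ_i` below. Both sides of the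
theorem satisfy the same branching rule for the removal of the largest admissible entry `N`, which
proves the theorem by induction on `N`; for this, parts and flags are allowed to be `0`. Entries and
variables are counted from `0`, so that the entry `N` is admissible in the rows with flag `N + 1`.

For tableaux (`tableauSum_eq_sum_cuts`), the entries `N` of a row with flag `N + 1` fill the
boxes from some column `v` on, and the smaller entries fill the first `m` boxes. The constraints are
`λ_{i+1} ≤ v ≤ m ≤ v + 1` and `m ≤ λ_i`, independently for each such row, since nothing can stand
below an entry `N`. The row contributes `β ^ (m - v) * x_N ^ (λ_i - v)`, and the smaller entries
form a tableau with parts `m` and flags bounded by `N`.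

For determinants (`det_jtMatrix_eq_sum_cuts`), raising a flag from `N` to `N + 1` multiplies the
generating function of the row by `(1 + β x) / (1 - x u)`, where `x = x_N`, an infinite series. The
identity `(1 + β x) / (1 - x u) - 1 = x (u + β) / (1 - x u)` (`rowH_succ_sub`) shows that the terms
with exponents below `λ_{i+1}` are a multiple of row `i + 1`, whose generating function carries one
more factor `u + β`. Subtracting this multiple leaves the finite sum of `row_expansion` over the
same pairs `(m, v)`, and multilinearity of the determinant gives the rule.

When all flags are `0`, both sides are `1` for the empty shape and `0` for every other shape
(`tableauSum_eq_det_zero`).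
-/

noncomputable section

namespace FlaggedGrothendieck

/-! ### Entries of the determinant as coefficients of one generating function -/

/-- The variable `x_{k+1}`: variables are counted from `0`, so that a flag `p` admits exactly the
entries `k < p`. -/
def xvar (k : ℕ) : PS := var k.succPNat

/-- The coefficient of `u ^ m` in `∏_{k < p} (1 + β x_k) / (1 - x_k u)`, where `p = 0` is
allowed. -/
def rowCoeff (p : ℕ) (m : ℤ) : PS :=
  if 0 ≤ m then PowerSeries.coeff m.toNat
    (∏ k ∈ Finset.range p, (PowerSeries.C (1 + beta * xvar k) * geom (xvar k))) else 0

theorem rowProdCoeff_succPNat (p : ℕ) (m : ℤ) :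
    rowProdCoeff p.succPNat m = rowCoeff (p + 1) m := by
  have h : Finset.Icc 1 p.succPNat = (Finset.range (p + 1)).image Nat.succPNat := by
    ext k
    simp only [Finset.mem_Icc, Finset.mem_image, Finset.mem_range]
    constructor
    · rintro ⟨_, h⟩
      refine ⟨k.natPred, ?_, PNat.succPNat_natPred k⟩
      have h' : (k : ℕ) ≤ p + 1 := h
      have := PNat.natPred_add_one k
      omega
    · rintro ⟨a, ha, rfl⟩
      exact ⟨one_le, Nat.succPNat_le_succPNat.2 (by omega)⟩
  rw [rowProdCoeff, rowCoeff, rowProd, h,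
    Finset.prod_image (Nat.succPNat_injective.injOn)]
  rfl

theorem rowCoeff_zero (m : ℤ) : rowCoeff 0 m = if m = 0 then 1 else 0 := by
  rw [rowCoeff, Finset.prod_range_zero, PowerSeries.coeff_one]
  split_ifs <;> first | rfl | omega

theorem rowCoeff_succ (p : ℕ) (m : ℤ) :
    rowCoeff (p + 1) m - xvar p * rowCoeff (p + 1) (m - 1) =
      (1 + beta * xvar p) * rowCoeff p m := by
  simp only [rowCoeff]
  set A := ∏ k ∈ Finset.range p, (PowerSeries.C (1 + beta * xvar k) * geom (xvar k)) with hA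
  set B := ∏ k ∈ Finset.range (p + 1), (PowerSeries.C (1 + beta * xvar k) * geom (xvar k))
    with hB
  have h : B - PowerSeries.C (xvar p) * (PowerSeries.X * B) =
      PowerSeries.C (1 + beta * xvar p) * A := by
    have := one_sub_mul_geom (xvar p)
    rw [hB, Finset.prod_range_succ, ← hA]
    linear_combination A * PowerSeries.C (1 + beta * xvar p) * this
  rcases lt_trichotomy m 0 with hm | hm | hm
  · rw [if_neg (by omega), if_neg (by omega), if_neg (by omega)]; simp
  · subst hm
    have h0 := congrArg (PowerSeries.coeff 0) h
    simpa using h0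
  · obtain ⟨n, rfl⟩ : ∃ n : ℕ, m = n + 1 := ⟨(m - 1).toNat, by omega⟩
    have h0 := congrArg (PowerSeries.coeff (n + 1)) h
    rw [map_sub, PowerSeries.coeff_C_mul, PowerSeries.coeff_C_mul,
      PowerSeries.coeff_succ_X_mul] at h0
    rw [if_pos (by omega), if_pos (by omega), if_pos (by omega)]
    have e1 : ((n : ℤ) + 1).toNat = n + 1 := by omega
    have e2 : ((n : ℤ) + 1 - 1).toNat = n := by omega
    rw [e1, e2]
    exact h0

/-- `G_m^{[p]}` for every natural number `p`. The empty product `p = 0` leaves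
`1 / (1 + β u⁻¹)`. -/
def rowG : ℕ → ℤ → PS
  | 0, m => if m ≤ 0 then (-beta) ^ (-m).toNat else 0
  | p + 1, m => oneRow p.succPNat m

theorem rowG_pnat (p : ℕ+) (m : ℤ) : rowG p m = oneRow p m := by
  obtain ⟨k, rfl⟩ : ∃ k : ℕ, p = k.succPNat := ⟨p.natPred, (PNat.succPNat_natPred p).symm⟩
  rfl

theorem rowG_rec (p : ℕ) (m : ℤ) : rowG p m + beta * rowG p (m + 1) = rowCoeff p m := by
  cases p with
  | zero =>
    simp only [rowG, rowCoeff_zero]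
    rcases lt_trichotomy m 0 with hm | hm | hm
    · rw [if_pos (by omega), if_pos (by omega), if_neg (by omega)]
      have e : (-m).toNat = (-(m + 1)).toNat + 1 := by omega
      rw [e, pow_succ]
      ring
    · subst hm
      simp
    · rw [if_neg (by omega), if_neg (by omega), if_neg (by omega)]
      simp
  | succ p =>
    rw [← rowProdCoeff_succPNat]
    exact oneRow_add _ _

/-- `A m` has order greater than or equal to `m - c` in `x`, so that `A m` tends to `0` as
`m → ∞`. -/
def Decays (c : ℤ) (A : ℤ → PS) : Prop :=
  ∀ (m : ℤ) (d : ℕ+ →₀ ℕ), (d.degree : ℤ) < m - c → MvPowerSeries.coeff d (A m) = 0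

theorem Decays.mono {c c' : ℤ} {A : ℤ → PS} (h : Decays c A) (hc : c ≤ c') : Decays c' A :=
  fun m d hd => h m d (by omega)

theorem Decays.shift {c : ℤ} {A : ℤ → PS} (h : Decays c A) (t : ℤ) :
    Decays (c - t) fun m => A (m + t) :=
  fun m d hd => h (m + t) d (by omega)

theorem Decays.sub {c : ℤ} {A B : ℤ → PS} (hA : Decays c A) (hB : Decays c B) :
    Decays c fun m => A m - B m := by
  intro m d hd
  simp only [map_sub, hA m d hd, hB m d hd, sub_zero]

theorem Decays.mul_left {c : ℤ} {A : ℤ → PS} (h : Decays c A) (a : PS) :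
    Decays c fun m => a * A m := by
  classical
  intro m d hd
  rw [MvPowerSeries.coeff_mul]
  refine Finset.sum_eq_zero fun q hq => ?_
  have e : q.1.degree + q.2.degree = d.degree := by
    rw [← Finset.HasAntidiagonal.mem_antidiagonal.1 hq, map_add]
  rw [h m q.2 (by omega), mul_zero]

/-- Division by `1 + β u⁻¹` is unambiguous among families that decay. -/
theorem Decays.eq_zero {c : ℤ} {A : ℤ → PS} (h : Decays c A)
    (hA : ∀ m, A m + beta * A (m + 1) = 0) (m : ℤ) : A m = 0 := by
  have key : ∀ k : ℕ, A m = MvPowerSeries.C ((-Polynomial.X : Polynomial ℤ) ^ k) * A (m + k) := by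
    intro k
    induction k with
    | zero => simp
    | succ k ih =>
      have e : m + ((k + 1 : ℕ) : ℤ) = m + k + 1 := by push_cast; ring
      have h1 := hA (m + k)
      rw [ih, e, pow_succ, map_mul, eq_neg_of_add_eq_zero_left h1, map_neg, ← beta]
      ring
  ext1 d
  obtain ⟨N, hN⟩ : ∃ N : ℕ, (d.degree : ℤ) < m + N - c :=
    ⟨((d.degree : ℤ) - m + c).toNat + 1, by omega⟩
  rw [key N, MvPowerSeries.coeff_C_mul, h _ _ hN, mul_zero, map_zero]

theorem decays_rowG (p : ℕ) : Decays 0 (rowG p) := by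
  intro m d hd
  cases p with
  | zero =>
    rw [rowG, if_neg (by omega), map_zero]
  | succ p => exact coeff_oneRow _ _ _ (by omega)

/-- Dividing the product defining `rowCoeff` by `1 + β u⁻¹` turns its recursion in `p` into one
for `rowG`. -/
theorem rowG_succ (p : ℕ) (m : ℤ) :
    rowG (p + 1) m - xvar p * rowG (p + 1) (m - 1) = (1 + beta * xvar p) * rowG p m := by
  have h : Decays 1 fun m =>
      rowG (p + 1) m - xvar p * rowG (p + 1) (m - 1) - (1 + beta * xvar p) * rowG p m :=
    (((decays_rowG _).mono (by omega)).sub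
      ((((decays_rowG _).shift (-1)).mono (by omega)).mul_left _)).sub
      (((decays_rowG _).mono (by omega)).mul_left _)
  refine sub_eq_zero.1 (h.eq_zero (fun m => ?_) m)
  have h1 := rowG_rec (p + 1) m
  have h2 := rowG_rec (p + 1) (m - 1)
  have h3 := rowG_rec p m
  have h4 := rowCoeff_succ p m
  rw [sub_add_cancel] at h2
  simp only [add_sub_cancel_right]
  linear_combination h1 - xvar p * h2 - (1 + beta * xvar p) * h3 + h4

/-- The coefficient of `u ^ m` in `(u + β) ^ a * ∑ₙ G_n^{[p]} uⁿ`, for every integer `a`; powers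
of `u + β` are expanded in `u⁻¹`. The `(i, j)` entry of the Jacobi-Trudi matrix is
`rowH f_i (i - j) λ_i`. -/
def rowH (p : ℕ) (a m : ℤ) : PS :=
  coeffSum fun s : ℕ => ((Ring.choose a s : ℤ) : PS) * beta ^ s * rowG p (m - a + s)

theorem coeff_choose_mul (a : ℤ) (s : ℕ) (A : PS) (d : ℕ+ →₀ ℕ) :
    MvPowerSeries.coeff d (((Ring.choose a s : ℤ) : PS) * beta ^ s * A) =
      ((Ring.choose a s : ℤ) : Polynomial ℤ) * Polynomial.X ^ s * MvPowerSeries.coeff d A := by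
  have e : ((Ring.choose a s : ℤ) : PS) * beta ^ s =
      MvPowerSeries.C (((Ring.choose a s : ℤ) : Polynomial ℤ) * Polynomial.X ^ s) := by
    simp [beta]
  rw [e, MvPowerSeries.coeff_C_mul]

theorem coeff_rowH_eq_sum (p : ℕ) (a m : ℤ) (d : ℕ+ →₀ ℕ) (N : ℕ)
    (h : (d.degree : ℤ) < m - a + N) :
    MvPowerSeries.coeff d (rowH p a m) = ∑ s ∈ Finset.range N,
      ((Ring.choose a s : ℤ) : Polynomial ℤ) * Polynomial.X ^ s *
        MvPowerSeries.coeff d (rowG p (m - a + s)) := by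
  have e : MvPowerSeries.coeff d (rowH p a m) = ∑ᶠ s : ℕ,
      ((Ring.choose a s : ℤ) : Polynomial ℤ) * Polynomial.X ^ s *
        MvPowerSeries.coeff d (rowG p (m - a + s)) :=
    finsum_congr fun s => coeff_choose_mul a s _ d
  rw [e]
  refine finsum_eq_sum_of_support_subset _ fun s hs => ?_
  rw [Finset.mem_coe, Finset.mem_range]
  by_contra hs'
  exact hs (by dsimp only; rw [decays_rowG p _ _ (by omega), mul_zero])

theorem decays_rowH (p : ℕ) (a : ℤ) : Decays a (rowH p a) := by
  intro m d hd
  rw [coeff_rowH_eq_sum p a m d 0 (by simpa using hd), Finset.sum_range_zero]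

theorem rowH_zero (p : ℕ) (m : ℤ) : rowH p 0 m = rowG p m := by
  ext1 d
  obtain ⟨N, hN⟩ : ∃ N : ℕ, (d.degree : ℤ) < m - 0 + (N + 1 : ℕ) :=
    ⟨((d.degree : ℤ) - m).toNat, by omega⟩
  rw [coeff_rowH_eq_sum p 0 m d (N + 1) hN, Finset.sum_range_succ', Finset.sum_eq_zero]
  · simp
  · intro s _
    simp [Ring.choose_zero_succ]

/-- Multiplication by `u + β`. -/
theorem rowH_add_one (p : ℕ) (a m : ℤ) :
    rowH p (a + 1) m = rowH p a (m - 1) + beta * rowH p a m := by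
  ext1 d
  obtain ⟨N, hN⟩ : ∃ N : ℕ, (d.degree : ℤ) < m - 1 - a + N :=
    ⟨((d.degree : ℤ) - (m - 1 - a)).toNat + 1, by omega⟩
  rw [coeff_rowH_eq_sum p (a + 1) m d (N + 1) (by push_cast; omega), map_add, beta,
    MvPowerSeries.coeff_C_mul, coeff_rowH_eq_sum p a (m - 1) d (N + 1) (by push_cast; omega),
    coeff_rowH_eq_sum p a m d N (by omega), Finset.sum_range_succ', Finset.sum_range_succ',
    Finset.mul_sum, add_right_comm, ← Finset.sum_add_distrib]
  congr 1
  · refine Finset.sum_congr rfl fun s _ => ?_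
    have e1 : m - (a + 1) + ((s + 1 : ℕ) : ℤ) = m - a + s := by push_cast; ring
    have e2 : m - 1 - a + ((s + 1 : ℕ) : ℤ) = m - a + s := by push_cast; ring
    rw [e1, e2, Ring.choose_succ_succ]
    push_cast
    ring
  · have e : m - (a + 1) = m - 1 - a := by ring
    simp [e]

/-- Multiplication by `(1 + β x_p) / (1 - x_p u)`, cleared of the denominator. -/
theorem rowH_succ (p : ℕ) (a m : ℤ) :
    rowH (p + 1) a m - xvar p * rowH (p + 1) a (m - 1) = (1 + beta * xvar p) * rowH p a m := by
  induction a using Int.induction_on generalizing m with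
  | zero => simpa only [rowH_zero] using rowG_succ p m
  | succ a ih =>
    simp only [rowH_add_one]
    linear_combination ih (m - 1) + beta * ih m
  | pred a ih =>
    have h : Decays (-(a : ℤ) - 1 + 1) fun m => rowH (p + 1) (-(a : ℤ) - 1) m -
        xvar p * rowH (p + 1) (-(a : ℤ) - 1) (m - 1) -
          (1 + beta * xvar p) * rowH p (-(a : ℤ) - 1) m :=
      (((decays_rowH _ _).mono (by omega)).sub
        ((((decays_rowH _ _).shift (-1)).mono (by omega)).mul_left _)).sub
        (((decays_rowH _ _).mono (by omega)).mul_left _)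
    refine sub_eq_zero.1 (h.eq_zero (fun m => ?_) m)
    have h0 := ih (m + 1)
    have h1 := rowH_add_one (p + 1) (-(a : ℤ) - 1) (m + 1)
    have h2 := rowH_add_one (p + 1) (-(a : ℤ) - 1) m
    have h3 := rowH_add_one p (-(a : ℤ) - 1) (m + 1)
    rw [sub_add_cancel] at h1 h2 h3
    simp only [add_sub_cancel_right] at *
    linear_combination h0 - h1 + xvar p * h2 + (1 + beta * xvar p) * h3

/-- Generating function of the difference: `(1 + β x) / (1 - x u) - 1 = x (u + β) / (1 - x u)`. -/
theorem rowH_succ_sub (p : ℕ) (a m : ℤ) :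
    (1 + beta * xvar p) * (rowH (p + 1) a m - rowH p a m) =
      xvar p * rowH (p + 1) (a + 1) m := by
  rw [rowH_add_one]
  linear_combination rowH_succ p a m

/-- For `a ≥ 1` the factor `1 / (1 + β u⁻¹)` cancels against `u + β`, which leaves a multiple
of `u`. -/
theorem rowH_eq_zero (p : ℕ) (a : ℕ) (m : ℤ) (hm : m ≤ 0) : rowH p (a + 1) m = 0 := by
  induction a generalizing m with
  | zero =>
    rw [rowH_add_one, Nat.cast_zero, rowH_zero, rowH_zero]
    have h := rowG_rec p (m - 1)
    rw [sub_add_cancel] at h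
    rw [h, rowCoeff, if_neg (by omega)]
  | succ a ih =>
    rw [rowH_add_one, Nat.cast_succ, ih _ (by omega), ih _ hm]
    simp

theorem rowH_zero_left (a m : ℤ) (h : a < m) : rowH 0 a m = 0 := by
  ext1 d
  change ∑ᶠ s : ℕ, MvPowerSeries.coeff d _ = _
  rw [map_zero]
  refine finsum_eq_zero_of_forall_eq_zero fun s => ?_
  rw [rowG, if_neg (by omega), mul_zero, map_zero]

theorem rowH_zero_zero_zero : rowH 0 0 0 = 1 := by
  rw [rowH_zero]
  simp [rowG]

theorem exists_inv_one_add (p : ℕ) : ∃ e : PS, e * (1 + beta * xvar p) = 1 := by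
  have h : IsUnit (1 + beta * xvar p : PS) := by
    rw [MvPowerSeries.isUnit_iff_constantCoeff]
    simp [xvar, var]
  exact h.exists_left_inv

/-! ### Tableaux and the removal of their largest entries -/

/-- A set-valued tableau of shape `lam` with flagging `f`, encoded as the set of all triples
(row, column, entry), where entries are counted from `0` and those of row `i` are less than `f i`.
Parts of `lam` and of `f` may be `0`. -/
structure IsTableau {r : ℕ} (lam f : Fin r → ℕ) (T : Finset (Fin r × ℕ × ℕ)) : Prop where
  box : ∀ i j, (∃ k, (i, j, k) ∈ T) ↔ j < lam i
  flag : ∀ i j k, (i, j, k) ∈ T → k < f i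
  row : ∀ i j j' k l, (i, j, k) ∈ T → (i, j', l) ∈ T → j < j' → k ≤ l
  column : ∀ i i' j k l, (i, j, k) ∈ T → (i', j, l) ∈ T → (i' : ℕ) = i + 1 → k < l

open Classical in
/-- The finite set of all tableaux of shape `lam` with flagging `f`. -/
def tableaux {r : ℕ} (lam f : Fin r → ℕ) : Finset (Finset (Fin r × ℕ × ℕ)) :=
  (Finset.univ ×ˢ Finset.range (∑ i, lam i) ×ˢ Finset.range (∑ i, f i)).powerset.filter
    (IsTableau lam f)

theorem mem_tableaux {r : ℕ} {lam f : Fin r → ℕ} {T : Finset (Fin r × ℕ × ℕ)} :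
    T ∈ tableaux lam f ↔ IsTableau lam f T := by
  simp only [tableaux, Finset.mem_filter, Finset.mem_powerset, and_iff_right_iff_imp]
  rintro h ⟨i, j, k⟩ ht
  have hj := (h.box i j).1 ⟨k, ht⟩
  have hk := h.flag i j k ht
  simp only [Finset.mem_product, Finset.mem_univ, Finset.mem_range, true_and]
  exact ⟨hj.trans_le (Finset.single_le_sum (f := lam) (by simp) (Finset.mem_univ i)),
    hk.trans_le (Finset.single_le_sum (f := f) (by simp) (Finset.mem_univ i))⟩

/-- The weight `β^{|T| - |λ|} ∏_{k ∈ T} x_k`. -/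
def tableauWeight {r : ℕ} (lam : Fin r → ℕ) (T : Finset (Fin r × ℕ × ℕ)) : PS :=
  beta ^ (T.card - ∑ i, lam i) * ∏ t ∈ T, xvar t.2.2

/-- The generating function of the tableaux of shape `lam` with flagging `f`. -/
def tableauSum {r : ℕ} (lam f : Fin r → ℕ) : PS :=
  ∑ T ∈ tableaux lam f, tableauWeight lam T

theorem IsTableau.sum_le_card {r : ℕ} {lam f : Fin r → ℕ} {T : Finset (Fin r × ℕ × ℕ)}
    (h : IsTableau lam f T) : ∑ i, lam i ≤ T.card := by
  have h1 : (Finset.univ.sigma fun i => Finset.range (lam i)) ⊆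
      T.image fun t => (⟨t.1, t.2.1⟩ : Σ _ : Fin r, ℕ) := by
    rintro ⟨i, j⟩ hb
    obtain ⟨k, hk⟩ := (h.box i j).2 (by simpa using hb)
    exact Finset.mem_image.2 ⟨_, hk, rfl⟩
  simpa using (Finset.card_le_card h1).trans Finset.card_image_le

/-- The next part `λ_{i+1}` of a partition, `0` after the last one. -/
def nextPart {r : ℕ} (lam : Fin r → ℕ) (i : Fin r) : ℕ :=
  if h : (i : ℕ) + 1 < r then lam ⟨i + 1, h⟩ else 0

theorem nextPart_eq {r : ℕ} {lam : Fin r → ℕ} {i i' : Fin r} (h : (i' : ℕ) = i + 1) :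
    nextPart lam i = lam i' := by
  have h' : (i : ℕ) + 1 < r := h ▸ i'.2
  rw [nextPart, dif_pos h']
  congr 1
  exact Fin.ext h.symm

/-- The pairs `(m, v)` with `L ≤ v ≤ m ≤ l` and `m ≤ v + 1`. They describe how a row of length `l`
above a row of length `L` can be cut: its first `m` boxes contain entries other than the largest
entry, and the boxes from column `v` on contain the largest entry, so that at most one box contains
both kinds. -/
def rowCuts (L l : ℕ) : Finset (ℕ × ℕ) :=
  (Finset.range (l + 1) ×ˢ Finset.range (l + 1)).filter
    fun q => L ≤ q.2 ∧ q.2 ≤ q.1 ∧ q.1 ≤ q.2 + 1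

theorem mem_rowCuts {L l : ℕ} {q : ℕ × ℕ} :
    q ∈ rowCuts L l ↔ L ≤ q.2 ∧ q.2 ≤ q.1 ∧ q.1 ≤ q.2 + 1 ∧ q.1 ≤ l := by
  simp only [rowCuts, Finset.mem_filter, Finset.mem_product, Finset.mem_range]
  omega

/-- The possible cuts of row `i` when the largest admissible entry is `N`, which occurs only in
rows with flag `N + 1`. -/
def cuts {r : ℕ} (lam f : Fin r → ℕ) (N : ℕ) (i : Fin r) : Finset (ℕ × ℕ) :=
  if f i = N + 1 then rowCuts (nextPart lam i) (lam i) else {(lam i, lam i)}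

theorem cuts_bounds {r : ℕ} {lam f : Fin r → ℕ} {N : ℕ} {i : Fin r} {q : ℕ × ℕ}
    (h : q ∈ cuts lam f N i) : q.2 ≤ q.1 ∧ q.1 ≤ q.2 + 1 ∧ q.1 ≤ lam i := by
  rw [cuts] at h
  split_ifs at h
  · rw [mem_rowCuts] at h
    omega
  · rw [Finset.mem_singleton] at h
    subst h
    simp

theorem nextPart_le_of_mem_cuts {r : ℕ} {lam f : Fin r → ℕ} (hlam : Antitone lam) {N : ℕ}
    {i : Fin r} {q : ℕ × ℕ} (h : q ∈ cuts lam f N i) : nextPart lam i ≤ q.2 := by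
  rw [cuts] at h
  split_ifs at h
  · exact (mem_rowCuts.1 h).1
  · rw [Finset.mem_singleton] at h
    subst h
    rw [nextPart]
    split_ifs
    · exact hlam (Fin.le_def.2 (Nat.le_succ _))
    · simp

theorem flag_of_mem_cuts {r : ℕ} {lam f : Fin r → ℕ} {N : ℕ} {i : Fin r} {q : ℕ × ℕ}
    (h : q ∈ cuts lam f N i) (hq : q.2 < lam i) : f i = N + 1 := by
  rw [cuts] at h
  split_ifs at h with hf
  · exact hf
  · rw [Finset.mem_singleton] at h
    subst h
    simp at hq

/-- The boxes of `lam` from column `v i` on in each row `i`, all filled with `N`. -/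
def strip {r : ℕ} (lam v : Fin r → ℕ) (N : ℕ) : Finset (Fin r × ℕ × ℕ) :=
  (Finset.univ.sigma fun i => Finset.Ico (v i) (lam i)).image fun b => (b.1, b.2, N)

theorem mem_strip {r : ℕ} {lam v : Fin r → ℕ} {N : ℕ} {i : Fin r} {j k : ℕ} :
    (i, j, k) ∈ strip lam v N ↔ v i ≤ j ∧ j < lam i ∧ k = N := by
  simp only [strip, Finset.mem_image, Finset.mem_sigma, Finset.mem_univ, Finset.mem_Ico,
    Prod.mk.injEq, true_and, Sigma.exists]
  constructor
  · rintro ⟨a, b, h, rfl, rfl, rfl⟩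
    exact ⟨h.1, h.2, rfl⟩
  · rintro ⟨h1, h2, rfl⟩
    exact ⟨i, j, ⟨h1, h2⟩, rfl, rfl, rfl⟩

theorem card_strip {r : ℕ} (lam v : Fin r → ℕ) (N : ℕ) :
    (strip lam v N).card = ∑ i, (lam i - v i) := by
  rw [strip, Finset.card_image_of_injective, Finset.card_sigma]
  · simp
  · rintro ⟨a, b⟩ ⟨c, d⟩ h
    simp only [Prod.mk.injEq] at h
    obtain ⟨rfl, rfl, -⟩ := h
    rfl

theorem prod_strip {r : ℕ} (lam v : Fin r → ℕ) (N : ℕ) :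
    ∏ t ∈ strip lam v N, xvar t.2.2 = ∏ i, xvar N ^ (lam i - v i) := by
  rw [Finset.prod_pow_eq_pow_sum, ← card_strip lam v N, ← Finset.prod_const]
  refine Finset.prod_congr rfl ?_
  rintro ⟨i, j, k⟩ h
  rw [(mem_strip.1 h).2.2]

section Step

variable {r : ℕ} {lam f : Fin r → ℕ} {N : ℕ}

theorem isTableau_union_strip (hlam : Antitone lam) {p : Fin r → ℕ × ℕ}
    (hp : ∀ i, p i ∈ cuts lam f N i) {T : Finset (Fin r × ℕ × ℕ)}
    (hT : IsTableau (fun i => (p i).1) (fun i => min (f i) N) T) :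
    IsTableau lam f (T ∪ strip lam (fun i => (p i).2) N) := by
  have hN : ∀ i j k, (i, j, k) ∈ T → k < N := fun i j k h =>
    (hT.flag i j k h).trans_le (min_le_right _ _)
  constructor
  · intro i j
    have hb := cuts_bounds (hp i)
    simp only [Finset.mem_union, mem_strip, exists_or, hT.box]
    constructor
    · rintro (h | ⟨k, h⟩) <;> omega
    · intro h
      by_cases hj : j < (p i).1
      · exact Or.inl hj
      · exact Or.inr ⟨N, by omega⟩
  · intro i j k h
    rcases Finset.mem_union.1 h with h | h
    · exact (hT.flag i j k h).trans_le (min_le_left _ _)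
    · rw [mem_strip] at h
      have := flag_of_mem_cuts (hp i) (by omega)
      omega
  · intro i j j' k l h h' hj
    rcases Finset.mem_union.1 h with h | h <;> rcases Finset.mem_union.1 h' with h' | h'
    · exact hT.row i j j' k l h h' hj
    · have := hN _ _ _ h
      rw [mem_strip] at h'
      omega
    · have h2 := (hT.box i j').1 ⟨l, h'⟩
      have hb := cuts_bounds (hp i)
      rw [mem_strip] at h
      omega
    · rw [mem_strip] at h h'
      omega
  · intro i i' j k l h h' hi
    have hj : j < lam i' := by
      have hb := cuts_bounds (hp i')
      rcases Finset.mem_union.1 h' with h' | h'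
      · have h2 := (hT.box i' j).1 ⟨l, h'⟩
        omega
      · exact (mem_strip.1 h').2.1
    rcases Finset.mem_union.1 h with h | h
    · rcases Finset.mem_union.1 h' with h' | h'
      · exact hT.column i i' j k l h h' hi
      · rw [mem_strip] at h'
        exact h'.2.2 ▸ hN _ _ _ h
    · have h1 := nextPart_le_of_mem_cuts hlam (hp i)
      rw [nextPart_eq hi] at h1
      rw [mem_strip] at h
      omega

theorem tableauWeight_union_strip {p : Fin r → ℕ × ℕ}
    (hp : ∀ i, p i ∈ cuts lam f N i) {T : Finset (Fin r × ℕ × ℕ)}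
    (hT : IsTableau (fun i => (p i).1) (fun i => min (f i) N) T) :
    tableauWeight lam (T ∪ strip lam (fun i => (p i).2) N) =
      (∏ i, (beta ^ ((p i).1 - (p i).2) * xvar N ^ (lam i - (p i).2))) *
        tableauWeight (fun i => (p i).1) T := by
  have hd : Disjoint T (strip lam (fun i => (p i).2) N) := by
    rw [Finset.disjoint_left]
    rintro ⟨i, j, k⟩ h h'
    have h1 := (hT.flag i j k h).trans_le (min_le_right _ _)
    rw [mem_strip] at h'
    omega
  have hc := hT.sum_le_card
  have h1 : ∑ i, (lam i - (p i).2) + ∑ i, (p i).2 = ∑ i, lam i := by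
    rw [← Finset.sum_add_distrib]
    exact Finset.sum_congr rfl fun i _ => by have := cuts_bounds (hp i); omega
  have h2 : ∑ i, ((p i).1 - (p i).2) + ∑ i, (p i).2 = ∑ i, (p i).1 := by
    rw [← Finset.sum_add_distrib]
    exact Finset.sum_congr rfl fun i _ => by have := cuts_bounds (hp i); omega
  have e : T.card + ∑ i, (lam i - (p i).2) - ∑ i, lam i =
      ∑ i, ((p i).1 - (p i).2) + (T.card - ∑ i, (p i).1) := by
    omega
  rw [tableauWeight, tableauWeight, Finset.card_union_of_disjoint hd, card_strip,
    Finset.prod_union hd, prod_strip, e, Finset.prod_mul_distrib,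
    Finset.prod_pow_eq_pow_sum, Finset.prod_pow_eq_pow_sum, pow_add]
  ring

/-- A tableau determines its entries below `N`, their shape, and the columns where the entries `N`
start. -/
theorem union_strip_injective {p p' : Fin r → ℕ × ℕ} (hp : ∀ i, p i ∈ cuts lam f N i)
    (hp' : ∀ i, p' i ∈ cuts lam f N i) {T T' : Finset (Fin r × ℕ × ℕ)}
    (hT : IsTableau (fun i => (p i).1) (fun i => min (f i) N) T)
    (hT' : IsTableau (fun i => (p' i).1) (fun i => min (f i) N) T')
    (h : T ∪ strip lam (fun i => (p i).2) N = T' ∪ strip lam (fun i => (p' i).2) N) :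
    p = p' ∧ T = T' := by
  have hN : ∀ i j k, (i, j, k) ∈ T → k < N := fun i j k h =>
    (hT.flag i j k h).trans_le (min_le_right _ _)
  have hN' : ∀ i j k, (i, j, k) ∈ T' → k < N := fun i j k h =>
    (hT'.flag i j k h).trans_le (min_le_right _ _)
  have hmem : ∀ i j k, ((i, j, k) ∈ T ∨ (p i).2 ≤ j ∧ j < lam i ∧ k = N) ↔
      ((i, j, k) ∈ T' ∨ (p' i).2 ≤ j ∧ j < lam i ∧ k = N) := by
    intro i j k
    have := congrArg (fun S => (i, j, k) ∈ S) h
    simpa only [Finset.mem_union, mem_strip, eq_iff_iff] using this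
  have hTT : T = T' := by
    ext ⟨i, j, k⟩
    have h0 := hmem i j k
    constructor
    · intro ht
      have := hN _ _ _ ht
      exact (h0.1 (Or.inl ht)).resolve_right (by omega)
    · intro ht
      have := hN' _ _ _ ht
      exact (h0.2 (Or.inl ht)).resolve_right (by omega)
  refine ⟨funext fun i => ?_, hTT⟩
  have h1 : (p i).1 = (p' i).1 := by
    have e : ∀ j, j < (p i).1 ↔ j < (p' i).1 := fun j => by
      rw [← hT.box i j, ← hT'.box i j, hTT]
    have e1 := e (p i).1
    have e2 := e (p' i).1
    omega
  have h2 : (p i).2 = (p' i).2 := by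
    have e : ∀ j, ((p i).2 ≤ j ∧ j < lam i) ↔ ((p' i).2 ≤ j ∧ j < lam i) := fun j => by
      have h0 := hmem i j N
      have a : (i, j, N) ∉ T := fun h => (hN _ _ _ h).false
      have b : (i, j, N) ∉ T' := fun h => (hN' _ _ _ h).false
      simpa [a, b] using h0
    have e1 := e (p i).2
    have e2 := e (p' i).2
    have b1 := cuts_bounds (hp i)
    have b2 := cuts_bounds (hp' i)
    omega
  exact Prod.ext h1 h2

theorem exists_cut (hlam : Antitone lam) (hf : ∀ i, f i ≤ N + 1) {T : Finset (Fin r × ℕ × ℕ)}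
    (hT : IsTableau lam f T) (i : Fin r) :
    ∃ q ∈ cuts lam f N i, (∀ j, (∃ k < N, (i, j, k) ∈ T) ↔ j < q.1) ∧
      ∀ j, (i, j, N) ∈ T ↔ q.2 ≤ j ∧ j < lam i := by
  classical
  have hk : ∀ i j k, (i, j, k) ∈ T → k ≤ N := fun i j k h => by
    have := hT.flag i j k h
    have := hf i
    omega
  have hj : ∀ i j k, (i, j, k) ∈ T → j < lam i := fun i j k h => (hT.box i j).1 ⟨k, h⟩
  have hm : ∃ m, ¬ ∃ k < N, (i, m, k) ∈ T :=
    ⟨lam i, fun ⟨k, _, h⟩ => (hj _ _ _ h).false⟩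
  have hv : ∃ v, lam i ≤ v ∨ (i, v, N) ∈ T := ⟨lam i, Or.inl le_rfl⟩
  obtain ⟨m, hm1, hm2⟩ : ∃ m, (¬ ∃ k < N, (i, m, k) ∈ T) ∧
      ∀ j < m, ∃ k < N, (i, j, k) ∈ T :=
    ⟨Nat.find hm, Nat.find_spec hm, fun j h => not_not.1 (Nat.find_min hm h)⟩
  obtain ⟨v, hv1, hv2⟩ : ∃ v, (lam i ≤ v ∨ (i, v, N) ∈ T) ∧
      ∀ j < v, ¬ (lam i ≤ j ∨ (i, j, N) ∈ T) :=
    ⟨Nat.find hv, Nat.find_spec hv, fun j h => Nat.find_min hv h⟩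
  have Hm : ∀ j, (∃ k < N, (i, j, k) ∈ T) ↔ j < m := by
    refine fun j => ⟨fun ⟨k, hkN, h⟩ => ?_, hm2 j⟩
    by_contra hmj
    have hml : m < lam i := by have := hj _ _ _ h; omega
    obtain ⟨l, hl⟩ := (hT.box i m).2 hml
    have hlN : ¬ l < N := fun hlt => hm1 ⟨l, hlt, hl⟩
    rcases (not_lt.1 hmj).lt_or_eq with h' | rfl
    · have := hT.row _ _ _ _ _ hl h h'
      omega
    · exact hm1 ⟨k, hkN, h⟩
  have hvl : v ≤ lam i := by
    by_contra hlt
    exact hv2 (lam i) (by omega) (Or.inl le_rfl)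
  have Hv : ∀ j, (i, j, N) ∈ T ↔ v ≤ j ∧ j < lam i := by
    refine fun j => ⟨fun h => ⟨?_, hj _ _ _ h⟩, fun ⟨h1, h2⟩ => ?_⟩
    · by_contra hlt
      exact hv2 j (by omega) (Or.inr h)
    · have hvN := hv1.resolve_left (by omega)
      rcases h1.lt_or_eq with h1 | rfl
      · obtain ⟨l, hl⟩ := (hT.box i j).2 h2
        have a := hT.row _ _ _ _ _ hvN hl h1
        have b := hk _ _ _ hl
        rwa [le_antisymm b a] at hl
      · exact hvN
  have hml : m ≤ lam i := by
    by_contra hlt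
    obtain ⟨k, _, h⟩ := hm2 (lam i) (by omega)
    exact (hj _ _ _ h).false
  have hvm : v ≤ m := by
    by_contra hlt
    obtain ⟨l, hl⟩ := (hT.box i m).2 (by omega)
    have a := hk _ _ _ hl
    rcases a.lt_or_eq with a | rfl
    · exact hm1 ⟨l, a, hl⟩
    · exact hlt ((Hv m).1 hl).1
  have hmv : m ≤ v + 1 := by
    by_contra hlt
    obtain ⟨k, hkN, h⟩ := hm2 (v + 1) (by omega)
    have := hT.row _ _ _ _ _ ((Hv v).2 ⟨le_rfl, by omega⟩) h (by omega)
    omega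
  refine ⟨(m, v), ?_, Hm, Hv⟩
  rw [cuts]
  split_ifs with hfi
  · refine mem_rowCuts.2 ⟨?_, hvm, hmv, hml⟩
    by_contra hlt
    rw [not_le, nextPart] at hlt
    split_ifs at hlt with hi
    · -- The box below column `v` would need an entry greater than `N`.
      obtain ⟨l, hl⟩ := (hT.box ⟨i + 1, hi⟩ v).2 hlt
      have hle : lam ⟨i + 1, hi⟩ ≤ lam i := hlam (Fin.le_def.2 (Nat.le_succ _))
      have a := hT.column i ⟨i + 1, hi⟩ v N l ((Hv v).2 ⟨le_rfl, by simp only at hlt; omega⟩) hl rfl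
      have b := hk _ _ _ hl
      omega
    · omega
  · have : v = lam i := by
      by_contra hne
      have := hT.flag _ _ _ ((Hv v).2 ⟨le_rfl, by omega⟩)
      have := hf i
      omega
    rw [Finset.mem_singleton]
    ext <;> simp only <;> omega

/-- Every tableau arises from the tableau of its entries below `N` by adding a strip of entries
`N`. -/
theorem exists_eq_union_strip (hlam : Antitone lam) (hf : ∀ i, f i ≤ N + 1)
    {T : Finset (Fin r × ℕ × ℕ)} (hT : IsTableau lam f T) :
    ∃ p : Fin r → ℕ × ℕ, (∀ i, p i ∈ cuts lam f N i) ∧ ∃ T',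
      IsTableau (fun i => (p i).1) (fun i => min (f i) N) T' ∧
        T' ∪ strip lam (fun i => (p i).2) N = T := by
  choose p hp hp1 hp2 using exists_cut hlam hf hT
  refine ⟨p, hp, T.filter fun t => t.2.2 < N, ⟨?_, ?_, ?_, ?_⟩, ?_⟩
  · intro i j
    rw [← hp1 i j]
    simp only [Finset.mem_filter, and_comm]
  · intro i j k h
    rw [Finset.mem_filter] at h
    exact lt_min (hT.flag i j k h.1) h.2
  · intro i j j' k l h h' hj
    exact hT.row i j j' k l (Finset.mem_filter.1 h).1 (Finset.mem_filter.1 h').1 hj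
  · intro i i' j k l h h' hi
    exact hT.column i i' j k l (Finset.mem_filter.1 h).1 (Finset.mem_filter.1 h').1 hi
  · ext ⟨i, j, k⟩
    rw [Finset.mem_union, Finset.mem_filter, mem_strip]
    constructor
    · rintro (h | ⟨h1, h2, rfl⟩)
      · exact h.1
      · exact (hp2 i j).2 ⟨h1, h2⟩
    · intro h
      by_cases hk : k < N
      · exact Or.inl ⟨h, hk⟩
      · have := hT.flag i j k h
        have := hf i
        obtain rfl : k = N := by omega
        have := (hp2 i j).1 h
        exact Or.inr ⟨this.1, this.2, rfl⟩

/-- Branching rule: a tableau is a tableau with smaller entries together with a strip of largest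
entries. -/
theorem tableauSum_eq_sum_cuts (hlam : Antitone lam) (hf : ∀ i, f i ≤ N + 1) :
    tableauSum lam f = ∑ p ∈ Fintype.piFinset (cuts lam f N),
      (∏ i, (beta ^ ((p i).1 - (p i).2) * xvar N ^ (lam i - (p i).2))) *
        tableauSum (fun i => (p i).1) (fun i => min (f i) N) := by
  simp only [tableauSum, Finset.mul_sum]
  rw [Finset.sum_sigma']
  symm
  refine Finset.sum_bij (fun q _ => q.2 ∪ strip lam (fun i => (q.1 i).2) N) ?_ ?_ ?_ ?_
  · rintro ⟨p, T⟩ h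
    simp only [Finset.mem_sigma, Fintype.mem_piFinset, mem_tableaux] at h
    exact mem_tableaux.2 (isTableau_union_strip hlam h.1 h.2)
  · rintro ⟨p, T⟩ h ⟨p', T'⟩ h' e
    simp only [Finset.mem_sigma, Fintype.mem_piFinset, mem_tableaux] at h h'
    obtain ⟨rfl, rfl⟩ := union_strip_injective h.1 h'.1 h.2 h'.2 e
    rfl
  · intro T hT
    obtain ⟨p, hp, T', hT', e⟩ := exists_eq_union_strip hlam hf (mem_tableaux.1 hT)
    exact ⟨⟨p, T'⟩, by
      simp only [Finset.mem_sigma, Fintype.mem_piFinset, mem_tableaux]; exact ⟨hp, hT'⟩, e⟩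
  · rintro ⟨p, T⟩ h
    simp only [Finset.mem_sigma, Fintype.mem_piFinset, mem_tableaux] at h
    exact (tableauWeight_union_strip h.1 h.2).symm

end Step

/-! ### The determinant satisfies the branching rule -/

/-- The Jacobi-Trudi matrix, with parts and flags allowed to be `0`. -/
def jtMatrix {r : ℕ} (lam f : Fin r → ℕ) : Matrix (Fin r) (Fin r) PS :=
  Matrix.of fun i j => rowH (f i) ((i : ℤ) - (j : ℤ)) (lam i)

/-- Telescoping of the generating function of the cuts of one row. -/
theorem sum_rowCuts {b x : PS} {S A : ℕ → PS}
    (h : ∀ m, S (m + 1) - x * S m = (1 + b * x) * A (m + 1)) {L l : ℕ} (hl : L ≤ l) :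
    ∑ q ∈ rowCuts L l, b ^ (q.1 - q.2) * x ^ (l - q.2) * A q.1 =
      S l - x ^ (l - L) * (S L - A L) := by
  induction l, hl using Nat.le_induction with
  | base =>
    have e : rowCuts L L = {(L, L)} := by
      ext ⟨m, v⟩
      simp only [mem_rowCuts, Finset.mem_singleton, Prod.mk.injEq]
      omega
    rw [e, Finset.sum_singleton]
    simp
  | succ l hl ih =>
    have e : rowCuts L (l + 1) = rowCuts L l ∪ {(l + 1, l + 1), (l + 1, l)} := by
      ext ⟨m, v⟩
      simp only [mem_rowCuts, Finset.mem_union, Finset.mem_insert, Finset.mem_singleton,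
        Prod.mk.injEq]
      omega
    have hd : Disjoint (rowCuts L l) {(l + 1, l + 1), (l + 1, l)} := by
      rw [Finset.disjoint_left]
      rintro ⟨m, v⟩ h1 h2
      simp only [mem_rowCuts, Finset.mem_insert, Finset.mem_singleton, Prod.mk.injEq] at h1 h2
      omega
    have e1 : ∑ q ∈ rowCuts L l, b ^ (q.1 - q.2) * x ^ (l + 1 - q.2) * A q.1 =
        x * (S l - x ^ (l - L) * (S L - A L)) := by
      rw [← ih, Finset.mul_sum]
      refine Finset.sum_congr rfl fun q hq => ?_
      rw [mem_rowCuts] at hq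
      have e2 : l + 1 - q.2 = l - q.2 + 1 := by omega
      rw [e2, pow_succ]
      ring
    rw [e, Finset.sum_union hd, e1, Finset.sum_pair (by simp)]
    have e3 : l + 1 - L = l - L + 1 := by omega
    have e4 : l + 1 - l = 1 := by omega
    rw [e3, e4, Nat.sub_self]
    linear_combination -h l

/-- Expansion of one row. In the rows with flag `N + 1` a multiple of the next row is subtracted:
by `rowH_succ_sub` this cuts the geometric series in `x_N` off at the length of the next row.
The last row needs no subtraction because of `rowH_eq_zero`. -/
theorem row_expansion {r : ℕ} {lam f : Fin r → ℕ} (hlam : Antitone lam) (hmono : Monotone f)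
    {N : ℕ} (hf : ∀ i, f i ≤ N + 1) (i : Fin r) :
    ∃ c : PS, ∀ j : Fin r,
      jtMatrix lam f i j - (if h : (i : ℕ) + 1 < r then c * jtMatrix lam f ⟨i + 1, h⟩ j else 0) =
        ∑ q ∈ cuts lam f N i, beta ^ (q.1 - q.2) * xvar N ^ (lam i - q.2) *
          rowH (min (f i) N) ((i : ℤ) - (j : ℤ)) q.1 := by
  by_cases hfi : f i = N + 1
  · obtain ⟨e, he⟩ := exists_inv_one_add N
    refine ⟨e * xvar N ^ (lam i - nextPart lam i + 1), fun j => ?_⟩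
    have hL : nextPart lam i ≤ lam i := by
      rw [nextPart]
      split_ifs
      · exact hlam (Fin.le_def.2 (Nat.le_succ _))
      · simp
    have hs : ∀ m : ℕ, rowH (N + 1) ((i : ℤ) - (j : ℤ)) ((m + 1 : ℕ) : ℤ) -
        xvar N * rowH (N + 1) ((i : ℤ) - (j : ℤ)) (m : ℤ) =
          (1 + beta * xvar N) * rowH N ((i : ℤ) - (j : ℤ)) ((m + 1 : ℕ) : ℤ) := by
      intro m
      have := rowH_succ N ((i : ℤ) - (j : ℤ)) ((m + 1 : ℕ) : ℤ)
      rwa [Nat.cast_succ, add_sub_cancel_right] at this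
    rw [cuts, if_pos hfi, min_eq_right (by omega)]
    rw [sum_rowCuts (S := fun m : ℕ => rowH (N + 1) ((i : ℤ) - (j : ℤ)) (m : ℤ))
      (A := fun m : ℕ => rowH N ((i : ℤ) - (j : ℤ)) (m : ℤ)) hs hL]
    have h1 := rowH_succ_sub N ((i : ℤ) - (j : ℤ)) (nextPart lam i)
    have h2 : (if h : (i : ℕ) + 1 < r then
        e * xvar N ^ (lam i - nextPart lam i + 1) * jtMatrix lam f ⟨i + 1, h⟩ j else 0) =
        e * xvar N ^ (lam i - nextPart lam i + 1) *
          rowH (N + 1) ((i : ℤ) - (j : ℤ) + 1) (nextPart lam i) := by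
      by_cases hi : (i : ℕ) + 1 < r
      · have hfi' : f ⟨i + 1, hi⟩ = N + 1 :=
          le_antisymm (hf _) (hfi ▸ hmono (Fin.le_def.2 (Nat.le_succ _)))
        rw [dif_pos hi, nextPart, dif_pos hi, jtMatrix, Matrix.of_apply, hfi']
        congr 2
        push_cast
        ring
      · have hj := j.2
        obtain ⟨a, ha⟩ : ∃ a : ℕ, (i : ℤ) - (j : ℤ) = a := ⟨(i : ℕ) - j, by omega⟩
        rw [dif_neg hi, nextPart, dif_neg hi, ha, rowH_eq_zero _ _ _ (by simp), mul_zero]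
    rw [h2, jtMatrix, Matrix.of_apply, hfi, pow_succ]
    linear_combination (e * xvar N ^ (lam i - nextPart lam i)) * h1 -
      (xvar N ^ (lam i - nextPart lam i) * (rowH (N + 1) ((i : ℤ) - (j : ℤ)) (nextPart lam i) -
        rowH N ((i : ℤ) - (j : ℤ)) (nextPart lam i))) * he
  · refine ⟨0, fun j => ?_⟩
    have : f i ≤ N := by
      have := hf i
      omega
    rw [cuts, if_neg hfi, Finset.sum_singleton, min_eq_left this]
    simp [jtMatrix]

/-- Subtracting from each row a multiple of the next one does not change a determinant. -/
theorem det_sub_next_row {R : Type*} [CommRing R] {r : ℕ} (A : Matrix (Fin r) (Fin r) R)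
    (c : Fin r → R) :
    (Matrix.of fun i j => A i j -
      (if h : (i : ℕ) + 1 < r then c i * A ⟨i + 1, h⟩ j else 0)).det = A.det := by
  let U : Matrix (Fin r) (Fin r) R := Matrix.of fun i k =>
    (if k = i then 1 else 0) - (if (k : ℕ) = i + 1 then c i else 0)
  have hU : U.det = 1 := by
    rw [Matrix.det_of_isUpperTriangular]
    · refine Finset.prod_eq_one fun i _ => ?_
      simp [U]
    · intro i k hk
      have hk : (k : ℕ) < i := hk
      have h1 : k ≠ i := fun h => by simp [h] at hk
      have h2 : (k : ℕ) ≠ i + 1 := by omega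
      simp [U, h1, h2]
  rw [← one_mul A.det, ← hU, ← Matrix.det_mul]
  congr 1
  ext i j
  simp only [U, Matrix.of_apply, Matrix.mul_apply, sub_mul, ite_mul, one_mul, zero_mul,
    Finset.sum_sub_distrib, Finset.sum_ite_eq', Finset.mem_univ, if_true]
  congr 1
  split_ifs with h
  · rw [Finset.sum_eq_single ⟨i + 1, h⟩]
    · simp
    · intro k _ hk
      rw [if_neg fun h' => hk (Fin.ext h')]
    · simp
  · symm
    refine Finset.sum_eq_zero fun k _ => if_neg ?_
    have := k.2
    omega

theorem det_jtMatrix_eq_sum_cuts {r : ℕ} {lam f : Fin r → ℕ} (hlam : Antitone lam)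
    (hmono : Monotone f) {N : ℕ} (hf : ∀ i, f i ≤ N + 1) :
    (jtMatrix lam f).det = ∑ p ∈ Fintype.piFinset (cuts lam f N),
      (∏ i, (beta ^ ((p i).1 - (p i).2) * xvar N ^ (lam i - (p i).2))) *
        (jtMatrix (fun i => (p i).1) (fun i => min (f i) N)).det := by
  choose c hc using row_expansion hlam hmono hf
  rw [← det_sub_next_row (jtMatrix lam f) c]
  have e : (Matrix.of fun i j => jtMatrix lam f i j -
      (if h : (i : ℕ) + 1 < r then c i * jtMatrix lam f ⟨i + 1, h⟩ j else 0)) =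
      fun i => ∑ q ∈ cuts lam f N i, (beta ^ (q.1 - q.2) * xvar N ^ (lam i - q.2)) •
        (fun j : Fin r => rowH (min (f i) N) ((i : ℤ) - (j : ℤ)) q.1) := by
    ext i j
    rw [Matrix.of_apply, hc i j, Finset.sum_apply]
    rfl
  rw [e]
  have h := (Matrix.detRowAlternating (R := PS) (n := Fin r)).toMultilinearMap.map_sum_finset
    (fun i (q : ℕ × ℕ) => (beta ^ (q.1 - q.2) * xvar N ^ (lam i - q.2)) •
        (fun j : Fin r => rowH (min (f i) N) ((i : ℤ) - (j : ℤ)) q.1)) (cuts lam f N)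
  refine h.trans (Finset.sum_congr rfl fun p _ => ?_)
  rw [MultilinearMap.map_smul_univ]
  rfl

theorem tableauSum_eq_det_zero {r : ℕ} {lam : Fin r → ℕ} (hlam : Antitone lam) :
    tableauSum lam 0 = (jtMatrix lam 0).det := by
  by_cases h : ∃ i, lam i ≠ 0
  · obtain ⟨i, hi⟩ := h
    let o : Fin r := ⟨0, i.pos⟩
    have ho : 0 < lam o := (Nat.pos_of_ne_zero hi).trans_le (hlam (Fin.le_def.2 (Nat.zero_le _)))
    rw [Matrix.det_eq_zero_of_row_eq_zero o, tableauSum, Finset.sum_eq_zero]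
    · intro T hT
      rw [mem_tableaux] at hT
      obtain ⟨k, hk⟩ := (hT.box o 0).2 ho
      exact absurd (hT.flag _ _ _ hk) (Nat.not_lt_zero _)
    · intro j
      refine rowH_zero_left _ _ ?_
      have : ((o : ℕ) : ℤ) = 0 := rfl
      omega
  · obtain rfl : lam = 0 := by
      funext i
      by_contra hi
      exact h ⟨i, hi⟩
    have h1 : tableaux (0 : Fin r → ℕ) 0 = {∅} := by
      ext T
      rw [mem_tableaux, Finset.mem_singleton]
      constructor
      · refine fun hT => Finset.eq_empty_of_forall_notMem ?_
        rintro ⟨i, j, k⟩ h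
        exact absurd (hT.flag _ _ _ h) (Nat.not_lt_zero _)
      · rintro rfl
        constructor <;> simp
    rw [Matrix.det_of_isUpperTriangular, tableauSum, h1]
    · simp [tableauWeight, jtMatrix, rowH_zero_zero_zero]
    · intro i j hij
      have hij : (j : ℕ) < i := hij
      obtain ⟨a, ha⟩ : ∃ a : ℕ, (i : ℤ) - (j : ℤ) = a + 1 := ⟨(i : ℕ) - j - 1, by omega⟩
      rw [jtMatrix, Matrix.of_apply, ha, rowH_eq_zero _ _ _ (by simp)]

theorem tableauSum_eq_det {r : ℕ} {lam f : Fin r → ℕ} (hlam : Antitone lam) (hf : Monotone f) :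
    tableauSum lam f = (jtMatrix lam f).det := by
  obtain ⟨N, hN⟩ : ∃ N, ∀ i, f i ≤ N :=
    ⟨∑ i, f i, fun i => Finset.single_le_sum (f := f) (by simp) (Finset.mem_univ i)⟩
  induction N generalizing lam f with
  | zero =>
    obtain rfl : f = 0 := funext fun i => Nat.le_zero.1 (hN i)
    exact tableauSum_eq_det_zero hlam
  | succ N ih =>
    rw [tableauSum_eq_sum_cuts hlam hN, det_jtMatrix_eq_sum_cuts hlam hf hN]
    refine Finset.sum_congr rfl fun p hp => ?_
    rw [Fintype.mem_piFinset] at hp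
    rw [ih _ (fun i i' h => min_le_min_right N (hf h)) fun i => min_le_right _ _]
    -- The cut shape is a partition, since each part is at least the next part of `lam`.
    intro i i' h
    rcases h.eq_or_lt with rfl | h
    · exact le_rfl
    · have hi : (i : ℕ) + 1 < r := by
        have := i'.2
        have : (i : ℕ) < i' := h
        omega
      have h1 := nextPart_le_of_mem_cuts hlam (hp i)
      rw [nextPart_eq (i' := ⟨i + 1, hi⟩) rfl] at h1
      have h2 : lam i' ≤ lam ⟨i + 1, hi⟩ := hlam (Fin.le_def.2 h)
      have h3 := cuts_bounds (hp i)
      have h4 := cuts_bounds (hp i')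
      dsimp only
      omega

/-! ### Comparison with fillings of the Young diagram -/

section Transfer

variable {r : ℕ} {lam : Fin r → ℕ} {f : Fin r → ℕ+}

/-- The triples (row, column, entry) of a filling, with entries counted from `0`. -/
def triples (T : Box lam → Finset ℕ+) : Finset (Fin r × ℕ × ℕ) :=
  (Finset.univ.sigma T).image fun t => (t.1.1, (t.1.2 : ℕ), t.2.natPred)

theorem mem_triples {T : Box lam → Finset ℕ+} {i : Fin r} {j k : ℕ} :
    (i, j, k) ∈ triples T ↔ ∃ h : j < lam i, k.succPNat ∈ T ⟨i, j, h⟩ := by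
  simp only [triples, Finset.mem_image, Finset.mem_sigma, Finset.mem_univ, true_and]
  constructor
  · rintro ⟨⟨⟨a, b⟩, n⟩, h, e⟩
    simp only [Prod.mk.injEq] at e
    obtain ⟨rfl, rfl, rfl⟩ := e
    exact ⟨b.2, by rwa [PNat.succPNat_natPred]⟩
  · rintro ⟨hj, h⟩
    exact ⟨⟨⟨i, j, hj⟩, k.succPNat⟩, h, by simp⟩

theorem mem_iff_mem_triples {T : Box lam → Finset ℕ+} {i : Fin r} {j : Fin (lam i)} {k : ℕ+} :
    k ∈ T ⟨i, j⟩ ↔ (i, (j : ℕ), k.natPred) ∈ triples T := by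
  rw [mem_triples, PNat.succPNat_natPred]
  exact ⟨fun h => ⟨j.2, h⟩, fun ⟨_, h⟩ => h⟩

theorem box_entry_injective :
    Function.Injective fun t : (Σ _ : Box lam, ℕ+) => (t.1.1, (t.1.2 : ℕ), t.2.natPred) := by
  rintro ⟨⟨a, b⟩, n⟩ ⟨⟨a', b'⟩, n'⟩ h
  simp only [Prod.mk.injEq] at h
  obtain ⟨rfl, h, h'⟩ := h
  obtain rfl := Fin.ext h
  obtain rfl := PNat.natPred_injective h'
  rfl

theorem card_triples (T : Box lam → Finset ℕ+) : (triples T).card = size T := by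
  rw [triples, Finset.card_image_of_injective _ box_entry_injective, Finset.card_sigma, size]

theorem prod_triples (T : Box lam → Finset ℕ+) :
    ∏ t ∈ triples T, xvar t.2.2 = ∏ b, ∏ k ∈ T b, var k := by
  rw [triples, Finset.prod_image box_entry_injective.injOn, Finset.prod_sigma]
  simp [xvar]

theorem triples_injective : Function.Injective (triples (lam := lam)) := by
  intro T T' h
  funext ⟨i, j⟩
  ext k
  rw [mem_iff_mem_triples, mem_iff_mem_triples, h]

/-- Along a row, the comparison of adjacent boxes propagates because no box is empty. -/
theorem IsFSVT.row_lt {T : Box lam → Finset ℕ+} (h : IsFSVT lam f T) (i : Fin r) (j : Fin (lam i))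
    (n : ℕ) (hn : (j : ℕ) + 1 + n < lam i) :
    ∀ k ∈ T ⟨i, j⟩, ∀ l ∈ T ⟨i, j + 1 + n, hn⟩, k ≤ l := by
  induction n with
  | zero => exact h.row i j ⟨j + 1, hn⟩ rfl
  | succ n ih =>
    intro k hk l hl
    obtain ⟨a, ha⟩ := h.nonempty ⟨i, j + 1 + n, by omega⟩
    exact (ih (by omega) k hk a ha).trans (h.row i ⟨j + 1 + n, by omega⟩ ⟨_, hn⟩ rfl a ha l hl)

theorem isTableau_triples {T : Box lam → Finset ℕ+} :
    IsTableau lam (fun i => (f i : ℕ)) (triples T) ↔ IsFSVT lam f T := by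
  have hle : ∀ k p : ℕ+, k ≤ p ↔ k.natPred < (p : ℕ) := fun k p => by
    rw [← PNat.coe_le_coe]
    have := PNat.natPred_add_one k
    omega
  constructor
  · intro h
    constructor
    · rintro ⟨i, j⟩
      obtain ⟨k, hk⟩ := (h.box i j).2 j.2
      obtain ⟨_, hk⟩ := mem_triples.1 hk
      exact ⟨_, hk⟩
    · rintro ⟨i, j⟩ k hk
      exact (hle _ _).2 (h.flag _ _ _ (mem_iff_mem_triples.1 hk))
    · intro i j j' hj k hk l hl
      exact PNat.natPred_le_natPred.1 (h.row _ _ _ _ _ (mem_iff_mem_triples.1 hk)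
        (mem_iff_mem_triples.1 hl) (by omega))
    · intro i i' j j' hi hj k hk l hl
      rw [mem_iff_mem_triples] at hk hl
      rw [hj] at hl
      exact PNat.natPred_lt_natPred.1 (h.column _ _ _ _ _ hk hl hi)
  · intro h
    constructor
    · intro i j
      constructor
      · rintro ⟨k, hk⟩
        exact (mem_triples.1 hk).1
      · intro hj
        obtain ⟨k, hk⟩ := h.nonempty ⟨i, j, hj⟩
        exact ⟨_, mem_iff_mem_triples.1 hk⟩
    · intro i j k hk
      obtain ⟨_, hk⟩ := mem_triples.1 hk
      simpa using (hle _ _).1 (h.flag _ _ hk)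
    · intro i j j' k l hk hl hj
      obtain ⟨h1, hk⟩ := mem_triples.1 hk
      obtain ⟨h2, hl⟩ := mem_triples.1 hl
      obtain ⟨n, rfl⟩ : ∃ n, j' = j + 1 + n := ⟨j' - (j + 1), by omega⟩
      exact Nat.succPNat_le_succPNat.1 (h.row_lt i ⟨j, h1⟩ n h2 _ hk _ hl)
    · intro i i' j k l hk hl hi
      obtain ⟨h1, hk⟩ := mem_triples.1 hk
      obtain ⟨h2, hl⟩ := mem_triples.1 hl
      exact Nat.succPNat_lt_succPNat.1 (h.column i i' ⟨j, h1⟩ ⟨j, h2⟩ hi rfl _ hk _ hl)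

theorem exists_triples_eq {S : Finset (Fin r × ℕ × ℕ)} {g : Fin r → ℕ} (hS : IsTableau lam g S) :
    ∃ T : Box lam → Finset ℕ+, triples T = S := by
  classical
  refine ⟨fun b => (S.filter fun t => t.1 = b.1 ∧ t.2.1 = (b.2 : ℕ)).image
    fun t => t.2.2.succPNat, ?_⟩
  ext ⟨i, j, k⟩
  rw [mem_triples]
  simp only [Finset.mem_image, Finset.mem_filter, Prod.exists]
  constructor
  · rintro ⟨_, a, b, c, ⟨h, rfl, rfl⟩, e⟩
    rwa [← Nat.succPNat_injective e]
  · intro h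
    exact ⟨(hS.box i j).1 ⟨k, h⟩, i, j, k, ⟨h, rfl, rfl⟩, rfl⟩

theorem coe_flaggedGrothendieck :
    (flaggedGrothendieck lam f : MvPowerSeries ℕ+ (Polynomial ℤ)) =
      tableauSum lam fun i => (f i : ℕ) := by
  rw [flaggedGrothendieck, ← MvPolynomial.coeToMvPowerSeries.ringHom_apply, map_sum, tableauSum]
  refine Finset.sum_bij (fun T _ => triples T) ?_ ?_ ?_ ?_
  · intro T hT
    exact mem_tableaux.2 (isTableau_triples.2 ((mem_FSVT lam f T).1 hT))
  · intro T _ T' _ h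
    exact triples_injective h
  · intro S hS
    rw [mem_tableaux] at hS
    obtain ⟨T, rfl⟩ := exists_triples_eq hS
    exact ⟨T, (mem_FSVT lam f T).2 (isTableau_triples.1 hS), rfl⟩
  · intro T _
    rw [tableauWeight, card_triples, prod_triples]
    simp only [map_mul, map_prod, MvPolynomial.coeToMvPowerSeries.ringHom_apply,
      MvPolynomial.coe_C, MvPolynomial.coe_X, map_pow, beta, var]

theorem jacobiTrudi_eq_det (lam : Fin r → ℕ) (f : Fin r → ℕ+) :
    jacobiTrudi lam f = (jtMatrix lam fun i => (f i : ℕ)).det := by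
  rw [jacobiTrudi, jtMatrix]
  congr 2
  funext i j
  rw [rowH]
  congr 1
  funext s
  rw [entryTerm, rowG_pnat]
  congr 2
  ring

end Transfer

end FlaggedGrothendieck

end

theorem theorem2p6 (r : ℕ) (lam : Fin r → ℕ) (hlam : Antitone lam) (hpos : ∀ i, 0 < lam i)
    (f : Fin r → ℕ+) (hf : Monotone f) :
    (FlaggedGrothendieck.flaggedGrothendieck lam f : MvPowerSeries ℕ+ (Polynomial ℤ)) =
        FlaggedGrothendieck.jacobiTrudi lam f ∧
      ∃ P : MvPolynomial ℕ+ (Polynomial ℤ),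
        (P : MvPowerSeries ℕ+ (Polynomial ℤ)) = FlaggedGrothendieck.jacobiTrudi lam f := by
  have h : (FlaggedGrothendieck.flaggedGrothendieck lam f :
      MvPowerSeries ℕ+ (Polynomial ℤ)) = FlaggedGrothendieck.jacobiTrudi lam f := by
    rw [FlaggedGrothendieck.coe_flaggedGrothendieck, FlaggedGrothendieck.jacobiTrudi_eq_det]
    exact FlaggedGrothendieck.tableauSum_eq_det hlam hf
  exact ⟨h, _, h⟩
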